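/- Let $\Delta=\{\zeta\in\mathbb C : |\zeta|<1\}$, let $\Delta^n\subset\mathbb C^n$ be the polydisk, i.e. the open unit ball of the norm $\|z\|=\max_j|z_j|$, and let $k_{\Delta^n}$ be its Kobayashi distance, i.e. the largest pseudodistance on $\Delta^n$ bounded above by the Lempert function $$\delta_{\Delta^n}(z,w)=\inf\{k_\Delta(\zeta,\eta) : \text{there is a holomorphic } \varphi\colon\Delta\to\Delta^n \text{ with } \varphi(\zeta)=z,\ \varphi(\eta)=w\},$$ where $k_\Delta(\zeta,\eta)=\frac12\log\frac{1+\rho}{1-\rho}$, $\rho=\left|\frac{\eta-\zeta}{1-\bar\zeta\eta}\right|$, is the Poincaré distance of $\Delta$. For a map $f\colon\Delta^n\to\Delta^n$, a map $h\colon\Delta^n\to\mathbb C^n$ is called a limit point of the sequence of iterates $\{f^k\}$ if some subsequence $\{f^{k_j}\}$ converges to $h$ uniformly on compact subsets of $\Delta^n$; the target set $T(f)$ is the union of the images $h(\Delta^n)$ over all limit points $h$ of $\{f^k\}$. **Corollary 4.1.** Let $f\colon\Delta^n\to\Delta^n$ be a self-map without fixed points which is $k_{\Delta^n}$-nonexpansive,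 i.e. $k_{\Delta^n}(f(z),f(w))\le k_{\Delta^n}(z,w)$ for all $z,w\in\Delta^n$ (for example, a holomorphic self-map). Then there exists $\xi\in\partial\Delta^n$ such that $$T(f)\subseteq\bigcup_{j=1}^n\overline\Delta\times\cdots\times C_j(\xi)\times\cdots\times\overline\Delta,$$ where $C_j(\xi)$ stands in the $j$-th position and $$C_j(\xi)=\begin{cases}\{\xi_j\}&\text{if }|\xi_j|=1,\\ \partial\Delta&\text{if }|\xi_j|<1.\end{cases}$$ -/

import Mathlib

open scoped ENNReal

noncomputable section

/-- The Poincaré distance of the unit disk `Δ ⊂ ℂ`: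
`k_Δ(ζ, η) = ½ log ((1 + ρ) / (1 - ρ))` with `ρ = |(η - ζ) / (1 - conj ζ * η)|`.
Only used at points of the open unit disk, where `ρ < 1`. -/
def poincareDist (ζ η : ℂ) : ℝ :=
  (1 / 2) * Real.log
    ((1 + ‖(η - ζ) / (1 - (starRingEnd ℂ) ζ * η)‖) /
      (1 - ‖(η - ζ) / (1 - (starRingEnd ℂ) ζ * η)‖))

/-- The Lempert function of a subset `D` of a complex normed space: the infimum of `k_Δ(ζ, η)` over
all holomorphic maps `φ : Δ → D` with `φ ζ = z` and `φ η = w` (it is `∞` if there is none). -/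
def lempert {E : Type*} [NormedAddCommGroup E] [NormedSpace ℂ E] (D : Set E) (z w : E) : ℝ≥0∞ :=
  sInf {r | ∃ (φ : ℂ → E) (ζ η : ℂ),
    DifferentiableOn ℂ φ (Metric.ball 0 1) ∧ Set.MapsTo φ (Metric.ball 0 1) D ∧
    ζ ∈ Metric.ball (0 : ℂ) 1 ∧ η ∈ Metric.ball (0 : ℂ) 1 ∧ φ ζ = z ∧ φ η = w ∧
    r = ENNReal.ofReal (poincareDist ζ η)}

/-- `d` is an (extended) pseudodistance on the set `D`. -/
structure IsPseudoDistOn {E : Type*} (D : Set E) (d : E → E → ℝ≥0∞) : Prop where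
  self : ∀ z ∈ D, d z z = 0
  symm : ∀ z ∈ D, ∀ w ∈ D, d z w = d w z
  triangle : ∀ x ∈ D, ∀ y ∈ D, ∀ z ∈ D, d x z ≤ d x y + d y z

/-- The Kobayashi pseudodistance of `D`: the largest pseudodistance on `D` that is bounded above by
the Lempert function of `D`. -/
def kobayashi {E : Type*} [NormedAddCommGroup E] [NormedSpace ℂ E] (D : Set E) (z w : E) : ℝ≥0∞ :=
  sSup {r | ∃ d : E → E → ℝ≥0∞, IsPseudoDistOn D d ∧
    (∀ x ∈ D, ∀ y ∈ D, d x y ≤ lempert D x y) ∧ r = d z w}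

/-- `f` does not increase the Kobayashi pseudodistance of `D`. -/
def KobayashiNonexpansiveOn {E : Type*} [NormedAddCommGroup E] [NormedSpace ℂ E]
    (f : E → E) (D : Set E) : Prop :=
  ∀ z ∈ D, ∀ w ∈ D, kobayashi D (f z) (f w) ≤ kobayashi D z w

/-- `h` is a limit point of the iterates of `f` on `D`: some subsequence of the iterates converges
to `h` uniformly on compact subsets of `D`. -/
def IsIterateLimit {E : Type*} [NormedAddCommGroup E] (f : E → E) (D : Set E) (h : E → E) : Prop :=
  ∃ κ : ℕ → ℕ, StrictMono κ ∧
    ∀ K ⊆ D, IsCompact K → TendstoUniformlyOn (fun j => f^[κ j]) h Filter.atTop K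

/-- The target set `T(f)` of a self-map `f` of `D`: the union of the images `h(D)` of the limit
points `h` of the sequence of iterates. -/
def targetSet {E : Type*} [NormedAddCommGroup E] (f : E → E) (D : Set E) : Set E :=
  ⋃ h ∈ {h : E → E | IsIterateLimit f D h}, h '' D

/-- The polydisk `Δⁿ`: the open unit ball of `ℂⁿ` for the maximum norm. -/
def polydisk (n : ℕ) : Set (Fin n → ℂ) := Metric.ball 0 1

/-- `C_j(ξ)` is `{ξ_j}` if `|ξ_j| = 1`, and the unit circle otherwise. -/
def boundaryFactor {n : ℕ} (ξ : Fin n → ℂ) (j : Fin n) : Set ℂ :=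
  if ‖ξ j‖ = 1 then {ξ j} else Metric.sphere 0 1

end

open Filter Topology Metric UpperHalfPlane ComplexConjugate

/-! ### The unit disk and the upper half-plane -/

/-! By Schwarz–Pick, the Kobayashi distance of the polydisk is half the sup distance on `Fin n → ℍ`,
transported by the Cayley transform (`kobayashi_polydisk`), so `f` becomes a nonexpansive map of a
proper metric space. Two facts then combine.

Every limit value lies on the boundary: an orbit with an interior cluster point is bounded (Całka),
and a bounded orbit forces a fixed point (`exists_fixedPoint_of_isBounded_range_iterate`). So some
coordinate `l` of `h x` has modulus 1.

One coordinate is pinned down: for `r < 1` the map `r • f` has a fixed point. As `r → 1` these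
points accumulate at a boundary point `p`; on a subsequence the same coordinate `j` always has the
largest modulus, hence realizes the distance from the origin. Comparing distances to these points
keeps the `j`-th coordinate of each orbit in a horodisk at `p j` (`norm_iterate_sub_sq_le`), whose
closure meets the circle only at `p j`. So if `l = j`, then `h x j = p j`. -/

theorem norm_one_sub_conj_mul_sq (z w : ℂ) :
    ‖1 - conj z * w‖ ^ 2 = ‖z - w‖ ^ 2 + (1 - ‖z‖ ^ 2) * (1 - ‖w‖ ^ 2) := by
  simp only [Complex.sq_norm, Complex.normSq_apply, Complex.sub_re, Complex.sub_im,
    Complex.mul_re, Complex.mul_im, Complex.conj_re, Complex.conj_im, Complex.one_re,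
    Complex.one_im]
  ring

theorem one_sub_norm_sq_pos {z : ℂ} (hz : ‖z‖ < 1) : 0 < 1 - ‖z‖ ^ 2 := by
  nlinarith [norm_nonneg z]

theorem one_sub_conj_mul_ne_zero {z w : ℂ} (hz : ‖z‖ < 1) (hw : ‖w‖ < 1) :
    1 - conj z * w ≠ 0 := by
  intro h
  have := norm_one_sub_conj_mul_sq z w
  rw [h, norm_zero] at this
  nlinarith [mul_pos (one_sub_norm_sq_pos hz) (one_sub_norm_sq_pos hw), sq_nonneg ‖z - w‖]

/-- The Cayley transform of the unit disk onto the upper half-plane. -/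
noncomputable def cayley (z : ℂ) : ℍ := ofComplex (Complex.I * (1 + z) / (1 - z))

/-- The inverse of the Cayley transform. -/
noncomputable def cayleyInv (τ : ℍ) : ℂ := ((τ : ℂ) - Complex.I) / ((τ : ℂ) + Complex.I)

theorem one_sub_ne_zero_of_norm_lt_one {z : ℂ} (hz : ‖z‖ < 1) : 1 - z ≠ 0 := by
  intro h
  rw [← sub_eq_zero.1 h] at hz
  simp at hz

theorem cayley_aux_im (z : ℂ) :
    (Complex.I * (1 + z) / (1 - z)).im = (1 - ‖z‖ ^ 2) / ‖1 - z‖ ^ 2 := by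
  simp only [Complex.div_im, Complex.sq_norm, Complex.normSq_apply, Complex.sub_re, Complex.sub_im,
    Complex.mul_re, Complex.mul_im, Complex.add_re, Complex.add_im, Complex.one_re,
    Complex.one_im, Complex.I_re, Complex.I_im]
  ring

theorem cayley_aux_im_pos {z : ℂ} (hz : ‖z‖ < 1) : 0 < (Complex.I * (1 + z) / (1 - z)).im := by
  rw [cayley_aux_im]
  have := one_sub_norm_sq_pos hz
  have := norm_pos_iff.2 (one_sub_ne_zero_of_norm_lt_one hz)
  positivity

theorem coe_cayley {z : ℂ} (hz : ‖z‖ < 1) :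
    (cayley z : ℂ) = Complex.I * (1 + z) / (1 - z) := by
  rw [cayley, ofComplex_apply_of_im_pos (cayley_aux_im_pos hz)]

theorem cayley_im {z : ℂ} (hz : ‖z‖ < 1) : (cayley z).im = (1 - ‖z‖ ^ 2) / ‖1 - z‖ ^ 2 := by
  rw [← coe_im, coe_cayley hz, cayley_aux_im]

theorem coe_add_I_ne_zero (τ : ℍ) : (τ : ℂ) + Complex.I ≠ 0 := by
  intro h
  have := congrArg Complex.im h
  simp at this
  linarith [τ.im_pos]

theorem norm_cayleyInv_lt_one (τ : ℍ) : ‖cayleyInv τ‖ < 1 := by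
  rw [cayleyInv, norm_div, div_lt_one (norm_pos_iff.2 (coe_add_I_ne_zero τ)),
    ← sq_lt_sq₀ (norm_nonneg _) (norm_nonneg _), Complex.sq_norm, Complex.sq_norm]
  have := τ.im_pos
  simp [Complex.normSq_apply]
  nlinarith

theorem cayleyInv_cayley {z : ℂ} (hz : ‖z‖ < 1) : cayleyInv (cayley z) = z := by
  have h := coe_add_I_ne_zero (cayley z)
  rw [cayleyInv, div_eq_iff h, coe_cayley hz]
  have := one_sub_ne_zero_of_norm_lt_one hz
  field_simp
  ring

theorem cayley_cayleyInv (τ : ℍ) : cayley (cayleyInv τ) = τ := by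
  apply UpperHalfPlane.ext
  rw [coe_cayley (norm_cayleyInv_lt_one τ),
    div_eq_iff (one_sub_ne_zero_of_norm_lt_one (norm_cayleyInv_lt_one τ)), cayleyInv]
  have := coe_add_I_ne_zero τ
  field_simp
  ring_nf

theorem continuous_cayleyInv : Continuous cayleyInv := by
  unfold cayleyInv
  exact (continuous_coe.sub continuous_const).div (continuous_coe.add continuous_const)
    coe_add_I_ne_zero

theorem continuousOn_cayley : ContinuousOn cayley (ball 0 1) := by
  rw [isOpenEmbedding_coe.isInducing.continuousOn_iff]
  refine ContinuousOn.congr (f := fun z : ℂ => Complex.I * (1 + z) / (1 - z)) ?_ ?_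
  · refine ContinuousOn.div (by fun_prop) (by fun_prop) fun z hz => ?_
    exact one_sub_ne_zero_of_norm_lt_one (by simpa using hz)
  · intro z hz
    exact coe_cayley (by simpa using hz)

theorem cosh_dist_cayley {z w : ℂ} (hz : ‖z‖ < 1) (hw : ‖w‖ < 1) :
    Real.cosh (dist (cayley z) (cayley w)) =
      1 + 2 * (‖z - w‖ ^ 2 / ((1 - ‖z‖ ^ 2) * (1 - ‖w‖ ^ 2))) := by
  have hz' := one_sub_ne_zero_of_norm_lt_one hz
  have hw' := one_sub_ne_zero_of_norm_lt_one hw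
  have h1 : (cayley z : ℂ) - cayley w = 2 * Complex.I * (z - w) / ((1 - z) * (1 - w)) := by
    rw [coe_cayley hz, coe_cayley hw]
    field_simp
    ring
  have h2 := norm_ne_zero_iff.2 hz'
  have h3 := norm_ne_zero_iff.2 hw'
  have h4 := (one_sub_norm_sq_pos hz).ne'
  have h5 := (one_sub_norm_sq_pos hw).ne'
  rw [UpperHalfPlane.cosh_dist, cayley_im hz, cayley_im hw, dist_eq_norm, h1]
  simp only [norm_div, norm_mul, Complex.norm_I, Complex.norm_ofNat]
  field_simp

theorem tanh_half_dist_cayley {z w : ℂ} (hz : ‖z‖ < 1) (hw : ‖w‖ < 1) :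
    Real.tanh (dist (cayley z) (cayley w) / 2) = ‖(w - z) / (1 - conj z * w)‖ := by
  have hc := cosh_dist_cayley hz hw
  set d := dist (cayley z) (cayley w) with hd
  have h1 : Real.cosh d = Real.cosh (d / 2) ^ 2 + Real.sinh (d / 2) ^ 2 := by
    rw [← Real.cosh_two_mul]; congr 1; ring
  have h2 := Real.cosh_sq (d / 2)
  have h3 := norm_one_sub_conj_mul_sq z w
  have h4 := one_sub_norm_sq_pos hz
  have h5 := one_sub_norm_sq_pos hw
  have h6 := norm_pos_iff.2 (one_sub_conj_mul_ne_zero hz hw)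
  have hs : 0 ≤ Real.sinh (d / 2) := Real.sinh_nonneg_iff.2 (by positivity)
  have hcp := Real.cosh_pos (d / 2)
  rw [Real.tanh_eq_sinh_div_cosh, ← sq_eq_sq₀ (by positivity) (by positivity), div_pow, norm_div,
    div_pow, norm_sub_rev w z, h3]
  set s := ‖z - w‖ ^ 2
  have hs2 : Real.sinh (d / 2) ^ 2 = s / ((1 - ‖z‖ ^ 2) * (1 - ‖w‖ ^ 2)) := by linarith
  rw [h2, hs2]
  have : 0 ≤ s := sq_nonneg _
  field_simp

theorem poincareDist_eq_dist {z w : ℂ} (hz : ‖z‖ < 1) (hw : ‖w‖ < 1) :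
    poincareDist z w = dist (cayley z) (cayley w) / 2 := by
  rw [poincareDist, ← tanh_half_dist_cayley hz hw, ← Real.artanh_eq_half_log, Real.artanh_tanh]
  exact ⟨(Real.neg_one_lt_tanh _).le, (Real.tanh_lt_one _).le⟩

/-- Comparing hyperbolic distances in the disk amounts to comparing pseudohyperbolic ones. -/
theorem dist_cayley_le_iff {z w z' w' : ℂ} (hz : ‖z‖ < 1) (hw : ‖w‖ < 1) (hz' : ‖z'‖ < 1)
    (hw' : ‖w'‖ < 1) : dist (cayley z) (cayley w) ≤ dist (cayley z') (cayley w') ↔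
      ‖(w - z) / (1 - conj z * w)‖ ≤ ‖(w' - z') / (1 - conj z' * w')‖ := by
  rw [← tanh_half_dist_cayley hz hw, ← tanh_half_dist_cayley hz' hw',
    ← Real.artanh_le_artanh_iff ⟨Real.neg_one_lt_tanh _, Real.tanh_lt_one _⟩
      ⟨Real.neg_one_lt_tanh _, Real.tanh_lt_one _⟩, Real.artanh_tanh, Real.artanh_tanh,
    div_le_div_iff_of_pos_right two_pos]

/-- The disk automorphism that takes `0` to `a`. -/
noncomputable def diskAut (a ζ : ℂ) : ℂ := (ζ + a) / (1 + conj a * ζ)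

theorem one_add_conj_mul_ne_zero {a ζ : ℂ} (ha : ‖a‖ < 1) (hζ : ‖ζ‖ < 1) :
    1 + conj a * ζ ≠ 0 := by
  have := one_sub_conj_mul_ne_zero (z := -a) (w := ζ) (by simpa) hζ
  simpa using this

theorem norm_diskAut_lt_one {a ζ : ℂ} (ha : ‖a‖ < 1) (hζ : ‖ζ‖ < 1) : ‖diskAut a ζ‖ < 1 := by
  have h := norm_one_sub_conj_mul_sq (-a) ζ
  have h1 := mul_pos (one_sub_norm_sq_pos ha) (one_sub_norm_sq_pos hζ)
  have h2 : ‖-a - ζ‖ = ‖ζ + a‖ := by rw [← norm_neg]; congr 1; ring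
  have h3 : (1 : ℂ) - conj (-a) * ζ = 1 + conj a * ζ := by simp
  rw [h2, h3, norm_neg] at h
  rw [diskAut, norm_div, div_lt_one (norm_pos_iff.2 (one_add_conj_mul_ne_zero ha hζ)),
    ← sq_lt_sq₀ (norm_nonneg _) (norm_nonneg _)]
  linarith

theorem diskAut_neg (a ζ : ℂ) : diskAut (-a) ζ = (ζ - a) / (1 - conj a * ζ) := by
  simp [diskAut, sub_eq_add_neg]

theorem diskAut_diskAut_neg {a ζ : ℂ} (ha : ‖a‖ < 1) (hζ : ‖ζ‖ < 1) :
    diskAut a (diskAut (-a) ζ) = ζ := by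
  have h := one_sub_conj_mul_ne_zero ha hζ
  have h2 := one_add_conj_mul_ne_zero ha (norm_diskAut_lt_one (a := -a) (by simpa) hζ)
  rw [diskAut_neg] at h2 ⊢
  rw [diskAut, div_eq_iff h2]
  have e1 : (ζ - a) / (1 - conj a * ζ) * (1 - conj a * ζ) = ζ - a := div_mul_cancel₀ _ h
  linear_combination e1

theorem differentiableOn_diskAut {a : ℂ} (ha : ‖a‖ < 1) :
    DifferentiableOn ℂ (diskAut a) (ball 0 1) := by
  unfold diskAut
  refine DifferentiableOn.div (by fun_prop) (by fun_prop) fun ζ hζ => ?_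
  exact one_add_conj_mul_ne_zero ha (by simpa using hζ)

theorem mapsTo_diskAut {a : ℂ} (ha : ‖a‖ < 1) : Set.MapsTo (diskAut a) (ball 0 1) (ball 0 1) :=
  fun ζ hζ => by simpa using norm_diskAut_lt_one ha (by simpa using hζ)

/-- The **Schwarz–Pick lemma**. -/
theorem dist_cayley_le_of_mapsTo {φ : ℂ → ℂ} (hd : DifferentiableOn ℂ φ (ball 0 1))
    (hm : Set.MapsTo φ (ball 0 1) (ball 0 1)) {ζ η : ℂ} (hζ : ‖ζ‖ < 1) (hη : ‖η‖ < 1) :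
    dist (cayley (φ ζ)) (cayley (φ η)) ≤ dist (cayley ζ) (cayley η) := by
  have hφ : ∀ {x : ℂ}, ‖x‖ < 1 → ‖φ x‖ < 1 := fun {x} hx => by
    simpa using hm (x := x) (by simpa using hx)
  have hnφ : ‖-φ ζ‖ < 1 := by simpa using hφ hζ
  rw [dist_cayley_le_iff (hφ hζ) (hφ hη) hζ hη]
  -- Moving both `ζ` and `φ ζ` to the origin reduces the claim to the Schwarz lemma.
  let ψ : ℂ → ℂ := diskAut (-φ ζ) ∘ φ ∘ diskAut ζ
  have hψd : DifferentiableOn ℂ ψ (ball 0 1) :=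
    (differentiableOn_diskAut hnφ).comp (hd.comp (differentiableOn_diskAut hζ) (mapsTo_diskAut hζ))
      (hm.comp (mapsTo_diskAut hζ))
  have hψm : Set.MapsTo ψ (ball 0 1) (closedBall 0 1) :=
    ((mapsTo_diskAut hnφ).comp (hm.comp (mapsTo_diskAut hζ))).mono_right ball_subset_closedBall
  have hψ0 : ψ 0 = 0 := by
    simp [ψ, diskAut]
  have hη' : ‖diskAut (-ζ) η‖ < 1 := norm_diskAut_lt_one (by simpa) hη
  have := Complex.norm_le_norm_of_mapsTo_ball hψd hψm hψ0 hη'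
  simp only [ψ, Function.comp_apply, diskAut_diskAut_neg hζ hη] at this
  simpa only [diskAut_neg] using this

/-! ### The Kobayashi distance of the polydisk -/

theorem kobayashi_le_lempert {E : Type*} [NormedAddCommGroup E] [NormedSpace ℂ E] {D : Set E}
    {z w : E} (hz : z ∈ D) (hw : w ∈ D) : kobayashi D z w ≤ lempert D z w := by
  refine sSup_le ?_
  rintro r ⟨d, -, hd, rfl⟩
  exact hd z hz w hw

/-- Holomorphic self-maps do not increase the Kobayashi distance. -/
theorem DifferentiableOn.kobayashiNonexpansiveOn {E : Type*} [NormedAddCommGroup E]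
    [NormedSpace ℂ E] {D : Set E} {f : E → E} (hd : DifferentiableOn ℂ f D)
    (hm : Set.MapsTo f D D) : KobayashiNonexpansiveOn f D := by
  intro z hz w hw
  refine sSup_le ?_
  rintro r ⟨d, hpd, hdl, rfl⟩
  -- The pullback of an admissible pseudodistance along `f` is again admissible, since `f` carries
  -- analytic disks to analytic disks.
  refine le_sSup ⟨fun x y => d (f x) (f y), ⟨fun x hx => hpd.self _ (hm hx),
    fun x hx y hy => hpd.symm _ (hm hx) _ (hm hy),
    fun x hx y hy u hu => hpd.triangle _ (hm hx) _ (hm hy) _ (hm hu)⟩, fun x hx y hy => ?_, rfl⟩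
  refine (hdl _ (hm hx) _ (hm hy)).trans (le_sInf ?_)
  rintro r ⟨φ, ζ, η, hφ, hφm, hζ, hη, rfl, rfl, rfl⟩
  exact sInf_le ⟨f ∘ φ, ζ, η, hd.comp hφ hφm, hm.comp hφm, hζ, hη, rfl, rfl, rfl⟩

theorem mem_polydisk {n : ℕ} {z : Fin n → ℂ} : z ∈ polydisk n ↔ ∀ j, ‖z j‖ < 1 := by
  rw [polydisk, mem_ball_zero_iff, pi_norm_lt_iff one_pos]

/-- The Cayley transform in every coordinate. -/
noncomputable def cayleyPi {n : ℕ} (z : Fin n → ℂ) : Fin n → ℍ := fun j => cayley (z j)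

/-- The inverse Cayley transform in every coordinate. -/
noncomputable def cayleyPiInv {n : ℕ} (τ : Fin n → ℍ) : Fin n → ℂ := fun j => cayleyInv (τ j)

theorem cayleyPiInv_mem {n : ℕ} (τ : Fin n → ℍ) : cayleyPiInv τ ∈ polydisk n :=
  mem_polydisk.2 fun j => norm_cayleyInv_lt_one (τ j)

theorem cayleyPi_cayleyPiInv {n : ℕ} (τ : Fin n → ℍ) : cayleyPi (cayleyPiInv τ) = τ :=
  funext fun j => cayley_cayleyInv (τ j)

theorem cayleyPiInv_cayleyPi {n : ℕ} {z : Fin n → ℂ} (hz : z ∈ polydisk n) :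
    cayleyPiInv (cayleyPi z) = z :=
  funext fun j => cayleyInv_cayley (mem_polydisk.1 hz j)

theorem continuous_cayleyPiInv {n : ℕ} : Continuous (cayleyPiInv (n := n)) :=
  continuous_pi fun j => continuous_cayleyInv.comp (continuous_apply j)

theorem continuousOn_cayleyPi {n : ℕ} : ContinuousOn (cayleyPi (n := n)) (polydisk n) :=
  continuousOn_pi.2 fun j => continuousOn_cayley.comp (continuous_apply j).continuousOn
    fun z hz => by simpa using mem_polydisk.1 hz j

/-- Automorphisms move `z` to the origin. There the linear disk through the image of `w`, scaled so
that its largest coordinate becomes the parameter, is extremal. -/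
theorem lempert_polydisk_le {n : ℕ} {z w : Fin n → ℂ} (hz : z ∈ polydisk n)
    (hw : w ∈ polydisk n) :
    lempert (polydisk n) z w ≤ ENNReal.ofReal (dist (cayleyPi z) (cayleyPi w) / 2) := by
  rw [mem_polydisk] at hz hw
  have hmul : ∀ j, ‖diskAut (-z j) (w j)‖ < 1 := fun j =>
    norm_diskAut_lt_one (by simpa using hz j) (hw j)
  obtain ⟨ρ, hρ0, hρ1, hρ, hdist⟩ : ∃ ρ : ℝ, 0 ≤ ρ ∧ ρ < 1 ∧
      (∀ j, ‖diskAut (-z j) (w j)‖ ≤ ρ) ∧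
      dist (cayley 0) (cayley ρ) ≤ dist (cayleyPi z) (cayleyPi w) := by
    rcases isEmpty_or_nonempty (Fin n) with h | h
    · exact ⟨0, le_rfl, one_pos, fun j => h.elim j, by simp⟩
    · obtain ⟨i, hi⟩ := Finite.exists_max fun j => ‖diskAut (-z j) (w j)‖
      refine ⟨_, norm_nonneg _, hmul i, hi, le_trans ?_ (dist_le_pi_dist _ _ i)⟩
      simp only [cayleyPi]
      rw [dist_cayley_le_iff (by simp) (by simpa using hmul i) (hz i) (hw i),
        ← diskAut_neg (z i)]
      simp
  have hρn : ‖(ρ : ℂ)‖ < 1 := by simpa [abs_of_nonneg hρ0] using hρ1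
  have hc : ∀ j, ‖diskAut (-z j) (w j) / ρ‖ ≤ 1 := fun j => by
    rw [norm_div, Complex.norm_real, Real.norm_of_nonneg hρ0]
    exact div_le_one_of_le₀ (hρ j) hρ0
  have hlin : ∀ j, Set.MapsTo (fun ζ : ℂ => ζ * (diskAut (-z j) (w j) / ρ)) (ball 0 1) (ball 0 1) :=
    fun j ζ hζ => by
      rw [mem_ball_zero_iff] at hζ ⊢
      rw [norm_mul]
      exact (mul_le_of_le_one_right (norm_nonneg _) (hc j)).trans_lt hζ
  have hle : lempert (polydisk n) z w ≤ ENNReal.ofReal (poincareDist 0 ρ) := by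
    refine sInf_le ⟨fun ζ j => diskAut (z j) (ζ * (diskAut (-z j) (w j) / ρ)), 0, ρ, ?_, ?_,
      by simp, by simpa using hρn, ?_, ?_, rfl⟩
    · exact differentiableOn_pi.2 fun j =>
        (differentiableOn_diskAut (hz j)).comp (by fun_prop) (hlin j)
    · exact fun ζ hζ => mem_polydisk.2 fun j => by
        simpa using mapsTo_diskAut (hz j) (hlin j hζ)
    · ext j
      simp [diskAut]
    · ext j
      -- If `ρ = 0`, all the numerators vanish and the convention `0 / 0 = 0` still gives the right
      -- disk.
      have : (ρ : ℂ) * (diskAut (-z j) (w j) / ρ) = diskAut (-z j) (w j) := by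
        rcases hρ0.eq_or_lt with h | h
        · have h0 := hρ j
          rw [← h, norm_le_zero_iff] at h0
          simp [h0]
        · exact mul_div_cancel₀ _ (by exact_mod_cast h.ne')
      simp only [this, diskAut_diskAut_neg (hz j) (hw j)]
  refine hle.trans ?_
  rw [poincareDist_eq_dist (by simp) hρn]
  exact ENNReal.ofReal_le_ofReal (by linarith)

theorem le_lempert_polydisk {n : ℕ} (z w : Fin n → ℂ) :
    ENNReal.ofReal (dist (cayleyPi z) (cayleyPi w) / 2) ≤ lempert (polydisk n) z w := by
  refine le_sInf ?_
  rintro r ⟨φ, ζ, η, hφ, hφm, hζ, hη, rfl, rfl, rfl⟩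
  rw [mem_ball_zero_iff] at hζ hη
  rw [poincareDist_eq_dist hζ hη]
  refine ENNReal.ofReal_le_ofReal (div_le_div_of_nonneg_right ?_ zero_le_two)
  refine (dist_pi_le_iff dist_nonneg).2 fun j => ?_
  exact dist_cayley_le_of_mapsTo (φ := fun x => φ x j) (differentiableOn_pi.1 hφ j)
    (fun x hx => by simpa using mem_polydisk.1 (hφm hx) j) hζ hη

/-- The Kobayashi distance of the polydisk is the maximum of the hyperbolic distances of the
coordinates. -/
theorem kobayashi_polydisk {n : ℕ} {z w : Fin n → ℂ} (hz : z ∈ polydisk n)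
    (hw : w ∈ polydisk n) :
    kobayashi (polydisk n) z w = ENNReal.ofReal (dist (cayleyPi z) (cayleyPi w) / 2) := by
  refine le_antisymm ((kobayashi_le_lempert hz hw).trans (lempert_polydisk_le hz hw)) ?_
  refine le_sSup ⟨fun x y => ENNReal.ofReal (dist (cayleyPi x) (cayleyPi y) / 2), ⟨?_, ?_, ?_⟩,
    fun x _ y _ => le_lempert_polydisk x y, rfl⟩
  · intro x _
    simp
  · intro x _ y _
    simp only [dist_comm]
  · intro x _ y _ u _
    rw [← ENNReal.ofReal_add (by positivity) (by positivity)]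
    refine ENNReal.ofReal_le_ofReal ?_
    linarith [dist_triangle (cayleyPi x) (cayleyPi y) (cayleyPi u)]

theorem KobayashiNonexpansiveOn.dist_cayleyPi_le {n : ℕ} {f : (Fin n → ℂ) → (Fin n → ℂ)}
    (hf : KobayashiNonexpansiveOn f (polydisk n)) (hm : Set.MapsTo f (polydisk n) (polydisk n))
    {z w : Fin n → ℂ} (hz : z ∈ polydisk n) (hw : w ∈ polydisk n) :
    dist (cayleyPi (f z)) (cayleyPi (f w)) ≤ dist (cayleyPi z) (cayleyPi w) := by
  have h := hf z hz w hw
  rw [kobayashi_polydisk hz hw, kobayashi_polydisk (hm hz) (hm hw),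
    ENNReal.ofReal_le_ofReal_iff (by positivity)] at h
  linarith

/-! ### Nonexpansive maps -/

theorem dist_iterate_iterate_le {X : Type*} [MetricSpace X] {g : X → X}
    (hg : ∀ x y, dist (g x) (g y) ≤ dist x y) (k : ℕ) (x y : X) :
    dist (g^[k] x) (g^[k] y) ≤ dist x y := by
  induction k with
  | zero => simp
  | succ k ih =>
    rw [Function.iterate_succ_apply', Function.iterate_succ_apply']
    exact (hg _ _).trans ih

theorem dist_iterate_add_le {X : Type*} [MetricSpace X] {g : X → X}
    (hg : ∀ x y, dist (g x) (g y) ≤ dist x y) (x : X) (s k : ℕ) :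
    dist (g^[s + k] x) (g^[s] x) ≤ k * dist (g x) x := by
  induction k with
  | zero => simp
  | succ k ih =>
    have h := dist_iterate_iterate_le hg (s + k) (g x) x
    rw [← Function.iterate_succ_apply] at h
    calc _ ≤ dist (g^[s + k + 1] x) (g^[s + k] x) + dist (g^[s + k] x) (g^[s] x) :=
          dist_triangle _ _ _
      _ ≤ dist (g x) x + k * dist (g x) x := add_le_add h ih
      _ = _ := by push_cast; ring

/-- Theorem of **Całka**: an orbit of a nonexpansive map of a proper metric space is bounded as soon
as it has a cluster point. -/
theorem isBounded_range_iterate_of_frequently {X : Type*} [MetricSpace X] [ProperSpace X]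
    {g : X → X} (hg : ∀ x y, dist (g x) (g y) ≤ dist x y) {x y : X}
    (hy : ∃ᶠ k in atTop, dist (g^[k] x) y < 1 / 2) :
    Bornology.IsBounded (Set.range fun k => g^[k] x) := by
  set S : Set X := {p | (∃ k, p = g^[k] x) ∧ dist p y ≤ 1}
  have hSb : TotallyBounded S :=
    (isCompact_closedBall y 1).totallyBounded.subset fun p hp => hp.2
  -- A finite 1/2-net of the visits to the unit ball around `y`. Its finitely many return times have
  -- a bound `L`, and nonexpansiveness makes every visit recur within `L` steps: 1/2 from the net
  -- plus 1/2 from the return.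
  obtain ⟨t, htS, htf, ht⟩ := totallyBounded_iff_subset.1 hSb _ (dist_mem_uniformity one_half_pos)
  have hret : ∀ p ∈ S, ∃ m : ℕ, 1 ≤ m ∧ dist (g^[m] p) y < 1 / 2 := by
    rintro p ⟨⟨k, rfl⟩, -⟩
    obtain ⟨l, hl, hly⟩ := frequently_atTop.1 hy (k + 1)
    refine ⟨l - k, by omega, ?_⟩
    rwa [← Function.iterate_add_apply, Nat.sub_add_cancel (by omega)]
  choose! m hm1 hm2 using hret
  obtain ⟨L, hL⟩ := (htf.image m).bddAbove
  have hnext : ∀ k, dist (g^[k] x) y ≤ 1 → ∃ l, 1 ≤ l ∧ l ≤ L ∧ dist (g^[k + l] x) y ≤ 1 := by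
    intro k hk
    have := ht (show g^[k] x ∈ S from ⟨⟨k, rfl⟩, hk⟩)
    simp only [Set.mem_iUnion, Set.mem_ofPred_eq] at this
    obtain ⟨p, hp, hkp⟩ := this
    refine ⟨m p, hm1 p (htS hp), hL ⟨p, hp, rfl⟩, ?_⟩
    rw [add_comm, Function.iterate_add_apply]
    have h1 := dist_iterate_iterate_le hg (m p) (g^[k] x) p
    have h2 := hm2 p (htS hp)
    have h3 := dist_triangle (g^[m p] (g^[k] x)) (g^[m p] p) y
    linarith
  obtain ⟨k₀, hk₀⟩ := hy.exists
  -- From `k₀` on, the last visit is at most `L` steps old, so the orbit cannot have drifted by more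
  -- than `L * dist (g x) x` since then.
  have hrecent : ∀ i, ∃ s, dist (g^[s] x) y ≤ 1 ∧ s ≤ k₀ + i ∧ k₀ + i ≤ s + L := by
    intro i
    induction i with
    | zero => exact ⟨k₀, by linarith, le_rfl, by omega⟩
    | succ i ih =>
      obtain ⟨s, hs, hs1, hs2⟩ := ih
      by_cases h : k₀ + (i + 1) ≤ s + L
      · exact ⟨s, hs, by omega, h⟩
      · obtain ⟨l, hl1, hl2, hl⟩ := hnext s hs
        exact ⟨s + l, hl, by omega, by omega⟩
  have hsub : (Set.range fun k => g^[k] x) ⊆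
      ((fun k => g^[k] x) '' Set.Iio k₀) ∪ closedBall y (L * dist (g x) x + 1) := by
    rintro _ ⟨k, rfl⟩
    rcases lt_or_ge k k₀ with h | h
    · exact Or.inl ⟨k, h, rfl⟩
    · right
      obtain ⟨s, hs, hs1, hs2⟩ := hrecent (k - k₀)
      obtain ⟨l, hl⟩ := Nat.exists_eq_add_of_le (show s ≤ k by omega)
      have h1 := dist_iterate_add_le hg x s l
      rw [← hl] at h1
      have h2 : (l : ℝ) ≤ L := by exact_mod_cast (by omega : l ≤ L)
      have h3 := mul_le_mul_of_nonneg_right h2 (dist_nonneg (x := g x) (y := x))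
      have h4 := dist_triangle (g^[k] x) (g^[s] x) y
      rw [mem_closedBall]
      linarith
  exact (((Set.finite_Iio k₀).image _).isBounded.union isBounded_closedBall).subset hsub

/-- Theorem of **Edelstein**: a strictly distance decreasing self-map of a nonempty compact set has
a fixed point. -/
theorem IsCompact.exists_fixedPoint_of_dist_lt {X : Type*} [MetricSpace X] {K : Set X}
    (hK : IsCompact K) (hne : K.Nonempty) {T : X → X} (hm : Set.MapsTo T K K)
    (hT : ∀ x ∈ K, ∀ y ∈ K, x ≠ y → dist (T x) (T y) < dist x y) : ∃ x ∈ K, T x = x := by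
  have hc : ContinuousOn T K := by
    refine LipschitzOnWith.continuousOn (K := 1) (LipschitzOnWith.of_dist_le_mul ?_)
    intro x hx y hy
    rcases eq_or_ne x y with rfl | h
    · simp
    · simpa using (hT x hx y hy h).le
  -- A minimizer of the displacement must be fixed, since `T x` would otherwise have smaller
  -- displacement.
  obtain ⟨x, hx, hmin⟩ := hK.exists_isMinOn hne
    (continuous_dist.comp_continuousOn (hc.prodMk continuousOn_id))
  refine ⟨x, hx, by_contra fun h => ?_⟩
  exact (hT _ (hm hx) _ hx h).not_ge (hmin (hm hx))

theorem one_sub_one_div_add_two_mem (m : ℕ) :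
    (0 : ℝ) < 1 - 1 / (m + 2) ∧ 1 - 1 / ((m : ℝ) + 2) < 1 := by
  have : (0 : ℝ) < m + 2 := by positivity
  constructor
  · rw [sub_pos, div_lt_one this]
    linarith [(Nat.cast_nonneg m : (0 : ℝ) ≤ m)]
  · simpa using this

theorem tendsto_one_sub_one_div_add_two :
    Tendsto (fun m : ℕ => 1 - 1 / ((m : ℝ) + 2)) atTop (𝓝 1) := by
  have : Tendsto (fun m : ℕ => 1 - 1 / ((m : ℝ) + 2)) atTop (𝓝 (1 - 0)) :=
    tendsto_const_nhds.sub (tendsto_const_nhds.div_atTop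
      (tendsto_atTop_add_const_right _ _ tendsto_natCast_atTop_atTop))
  rwa [sub_zero] at this

/-- The point `(1 - t) a + t z` of the upper half-plane. -/
noncomputable def UpperHalfPlane.combo (t : ℝ) (a z : ℍ) : ℍ :=
  ofComplex ((1 - t) * a + t * z)

theorem UpperHalfPlane.coe_combo {t : ℝ} (h0 : 0 < t) (h1 : t < 1) (a z : ℍ) :
    (combo t a z : ℂ) = (1 - t) * a + t * z := by
  rw [combo, ofComplex_apply_of_im_pos]
  have := a.im_pos
  have := z.im_pos
  have : 0 < 1 - t := by linarith
  have h : ((1 - t) * (a : ℂ) + t * z).im = (1 - t) * a.im + t * z.im := by simp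
  rw [h]
  positivity

theorem UpperHalfPlane.combo_im {t : ℝ} (h0 : 0 < t) (h1 : t < 1) (a z : ℍ) :
    (combo t a z).im = (1 - t) * a.im + t * z.im := by
  rw [← coe_im, coe_combo h0 h1]
  simp

/-- The Euclidean distance shrinks by exactly `t`, while the imaginary parts shrink by less because
`a` contributes a positive height. -/
theorem UpperHalfPlane.dist_combo_lt {t : ℝ} (h0 : 0 < t) (h1 : t < 1) (a : ℍ) {z w : ℍ}
    (h : z ≠ w) : dist (combo t a z) (combo t a w) < dist z w := by
  have ha := a.im_pos
  have hz := z.im_pos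
  have hw := w.im_pos
  have hd : dist (combo t a z : ℂ) (combo t a w) = t * dist (z : ℂ) w := by
    rw [coe_combo h0 h1, coe_combo h0 h1, dist_add_left, dist_eq_norm, dist_eq_norm, ← mul_sub,
      norm_mul, Complex.norm_real, Real.norm_of_nonneg h0.le]
  have hzw : 0 < dist (z : ℂ) w := dist_pos.2 fun h' => h (UpperHalfPlane.ext h')
  have hlt : ∀ u : ℍ, t * u.im < (combo t a u).im := fun u => by
    rw [combo_im h0 h1]
    nlinarith
  rw [← abs_of_nonneg (dist_nonneg (x := z)), ← abs_of_nonneg (dist_nonneg (x := combo t a z)),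
    ← Real.cosh_lt_cosh, cosh_dist, cosh_dist, hd, add_lt_add_iff_left]
  calc _ < (t * dist (z : ℂ) w) ^ 2 / (2 * (t * z.im) * (t * w.im)) := by
        gcongr
        · exact hlt z
        · exact hlt w
    _ = _ := by field_simp

/-- Hyperbolic balls are Euclidean balls with another center, hence convex. -/
theorem UpperHalfPlane.dist_combo_le {t : ℝ} (h0 : 0 < t) (h1 : t < 1) {a z w : ℍ} {r : ℝ}
    (ha : dist a w ≤ r) (hz : dist z w ≤ r) : dist (combo t a z) w ≤ r := by
  rw [dist_le_iff_dist_coe_center_le] at *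
  rw [coe_combo h0 h1]
  have := convex_closedBall (w.center r : ℂ) (w.im * Real.sinh r) (mem_closedBall.2 ha)
    (mem_closedBall.2 hz) (sub_nonneg.2 h1.le) h0.le (by ring)
  simpa using this

/-- A nonexpansive self-map of a power of the upper half-plane with a bounded orbit has a fixed
point. -/
theorem exists_fixedPoint_of_isBounded_range_iterate {n : ℕ} {g : (Fin n → ℍ) → (Fin n → ℍ)}
    (hg : ∀ x y, dist (g x) (g y) ≤ dist x y) {x : Fin n → ℍ}
    (hb : Bornology.IsBounded (Set.range fun k => g^[k] x)) : ∃ y, g y = y := by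
  obtain ⟨R, hR⟩ := isBounded_iff.1 hb
  have hR0 : 0 ≤ R := dist_nonneg.trans (hR (Set.mem_range_self 0) (Set.mem_range_self 0))
  -- The points whose limsup distance to the orbit is at most `R`. This set is compact, closed under
  -- `combo`, and invariant under `g` because a limsup ignores a shift of the index.
  set K : Set (Fin n → ℍ) := {y | ∀ r, R < r → ∀ᶠ k in atTop, dist y (g^[k] x) ≤ r}
  have hxK : x ∈ K := fun r hr => Eventually.of_forall fun k =>
    (hR (Set.mem_range_self 0) (Set.mem_range_self k)).trans hr.le
  have hKb : K ⊆ closedBall x (2 * R + 1) := by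
    intro y hy
    obtain ⟨k, hk⟩ := (hy (R + 1) (by linarith)).exists
    have h1 := hR (Set.mem_range_self k) (Set.mem_range_self 0)
    have h2 := dist_triangle y (g^[k] x) x
    simp only [Function.iterate_zero, id] at h1
    rw [mem_closedBall]
    linarith
  have hKc : IsClosed K := by
    refine isClosed_of_closure_subset fun y hy r hr => ?_
    obtain ⟨z, hz, hyz⟩ := Metric.mem_closure_iff.1 hy ((r - R) / 2) (by linarith)
    filter_upwards [hz ((r + R) / 2) (by linarith)] with k hk
    linarith [dist_triangle y z (g^[k] x)]
  have hK : IsCompact K := (isCompact_closedBall x _).of_isClosed_subset hKc hKb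
  have hgK : Set.MapsTo g K K := by
    intro y hy r hr
    rw [← map_add_atTop_eq_nat 1, eventually_map]
    filter_upwards [hy r hr] with k hk
    rw [Function.iterate_succ_apply']
    exact (hg _ _).trans hk
  -- Edelstein's theorem applies to `g` followed by a pull towards `x`; letting `t → 1` then gives a
  -- fixed point of `g`.
  have happrox : ∀ t : ℝ, 0 < t → t < 1 →
      ∃ y ∈ K, (fun j => combo t (x j) (g y j)) = y := by
    intro t h0 h1
    refine hK.exists_fixedPoint_of_dist_lt ⟨x, hxK⟩ ?_ ?_
    · intro y hy r hr
      filter_upwards [hxK r hr, hgK hy r hr] with k hk1 hk2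
      have hr0 : 0 ≤ r := hR0.trans hr.le
      rw [dist_pi_le_iff hr0] at hk1 hk2 ⊢
      exact fun j => dist_combo_le h0 h1 (hk1 j) (hk2 j)
    · intro y _ z _ hyz
      refine (dist_pi_lt_iff (dist_pos.2 hyz)).2 fun j => ?_
      rcases eq_or_ne (g y j) (g z j) with h | h
      · simpa only [h, dist_self] using dist_pos.2 hyz
      · exact (dist_combo_lt h0 h1 _ h).trans_le ((dist_le_pi_dist _ _ j).trans (hg y z))
  choose y hyK hy using fun m : ℕ =>
    happrox _ (one_sub_one_div_add_two_mem m).1 (one_sub_one_div_add_two_mem m).2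
  obtain ⟨p, -, κ, hκ, hp⟩ := hK.tendsto_subseq hyK
  have hgc : Continuous g :=
    (LipschitzWith.of_dist_le_mul (K := 1) fun x y => by simpa using hg x y).continuous
  refine ⟨p, funext fun j => UpperHalfPlane.ext ?_⟩
  have h1 : Tendsto (fun m => ((y (κ m) j : ℍ) : ℂ)) atTop (𝓝 (p j)) :=
    (continuous_coe.tendsto _).comp (((continuous_apply j).tendsto p).comp hp)
  have h2 : Tendsto (fun m => ((g (y (κ m)) j : ℍ) : ℂ)) atTop (𝓝 (g p j)) :=
    (continuous_coe.tendsto _).comp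
      (((continuous_apply j).tendsto (g p)).comp ((hgc.tendsto p).comp hp))
  have h3 : Tendsto (fun m : ℕ => (((1 - 1 / ((m : ℝ) + 2) : ℝ)) : ℂ)) atTop (𝓝 1) := by
    exact_mod_cast (Complex.continuous_ofReal.tendsto 1).comp tendsto_one_sub_one_div_add_two
  have h4 := h3.comp hκ.tendsto_atTop
  have h5 := ((tendsto_const_nhds (x := (1 : ℂ))).sub h4).mul_const (x j : ℂ) |>.add (h4.mul h2)
  rw [sub_self, zero_mul, one_mul, zero_add] at h5
  refine tendsto_nhds_unique h5 (h1.congr fun m => ?_)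
  conv_lhs => rw [← hy (κ m)]
  rw [coe_combo (one_sub_one_div_add_two_mem _).1 (one_sub_one_div_add_two_mem _).2]
  rfl

/-! ### Iterates of nonexpansive maps of the polydisk -/

/-- In the formula for `cosh`, the numerator scales by `r ^ 2`, while each factor of the denominator
stays above `r` times its old value. -/
theorem dist_cayley_mul_lt {r : ℝ} (h0 : 0 < r) (h1 : r < 1) {z w : ℂ} (hz : ‖z‖ < 1)
    (hw : ‖w‖ < 1) (h : z ≠ w) :
    dist (cayley (r * z)) (cayley (r * w)) < dist (cayley z) (cayley w) := by
  have hn : ∀ u : ℂ, ‖(r : ℂ) * u‖ = r * ‖u‖ := fun u => by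
    rw [norm_mul, Complex.norm_real, Real.norm_of_nonneg h0.le]
  have hlt : ∀ {u : ℂ}, ‖u‖ < 1 → ‖(r : ℂ) * u‖ < 1 := fun {u} hu => by
    rw [hn]
    nlinarith [norm_nonneg u]
  have hpos : 0 < ‖z - w‖ := norm_pos_iff.2 (sub_ne_zero.2 h)
  have hz1 := one_sub_norm_sq_pos hz
  have hw1 := one_sub_norm_sq_pos hw
  have key : ∀ u : ℂ, r * (1 - ‖u‖ ^ 2) < 1 - (r * ‖u‖) ^ 2 := fun u => by
    nlinarith [mul_nonneg (mul_nonneg h0.le (sub_nonneg.2 h1.le)) (sq_nonneg ‖u‖)]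
  rw [← abs_of_nonneg (dist_nonneg (x := cayley z)),
    ← abs_of_nonneg (dist_nonneg (x := cayley (r * z))),
    ← Real.cosh_lt_cosh, cosh_dist_cayley hz hw, cosh_dist_cayley (hlt hz) (hlt hw), ← mul_sub,
    hn, hn, hn, add_lt_add_iff_left]
  refine mul_lt_mul_of_pos_left ?_ two_pos
  calc _ < (r * ‖z - w‖) ^ 2 / ((r * (1 - ‖z‖ ^ 2)) * (r * (1 - ‖w‖ ^ 2))) := by
        gcongr
        · exact key z
        · exact key w
    _ = _ := by field_simp

/-- Points that are not much farther from `z` than the origin is satisfy a Euclidean estimate that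
is uniform in `z`. -/
theorem norm_sub_sq_le_of_dist_cayley_le {R : ℝ} {w z : ℂ} (hw : ‖w‖ < 1) (hz : ‖z‖ < 1)
    (h : dist (cayley w) (cayley z) ≤ R + dist (cayley 0) (cayley z)) :
    ‖w - z‖ ^ 2 ≤ 2 * Real.exp R * (1 - ‖w‖ ^ 2) := by
  have hz1 := one_sub_norm_sq_pos hz
  have hw1 := one_sub_norm_sq_pos hw
  have c1 := cosh_dist_cayley hw hz
  have c0 := cosh_dist_cayley (z := 0) (by simp) hz
  set d := dist (cayley w) (cayley z) with hd
  set d₀ := dist (cayley 0) (cayley z)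
  have e1 : Real.cosh d ≤ Real.exp d := by
    rw [Real.cosh_eq]
    have : Real.exp (-d) ≤ Real.exp d :=
      Real.exp_le_exp.2 (by linarith [dist_nonneg.trans_eq hd.symm])
    linarith
  have e2 : Real.exp d ≤ Real.exp R * Real.exp d₀ := by
    rw [← Real.exp_add]
    exact Real.exp_le_exp.2 h
  have e3 : Real.exp d₀ ≤ 2 * Real.cosh d₀ := by
    rw [Real.cosh_eq]
    linarith [Real.exp_pos (-d₀)]
  have e4 : Real.cosh d₀ ≤ 2 / (1 - ‖z‖ ^ 2) := by
    rw [c0]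
    simp only [zero_sub, norm_neg, norm_zero]
    rw [le_div_iff₀ hz1]
    field_simp
    nlinarith
  have hR := Real.exp_pos R
  have e5 : 2 * (‖w - z‖ ^ 2 / ((1 - ‖w‖ ^ 2) * (1 - ‖z‖ ^ 2))) ≤
      Real.exp R * (2 * (2 / (1 - ‖z‖ ^ 2))) := by
    have : Real.exp R * Real.exp d₀ ≤ Real.exp R * (2 * (2 / (1 - ‖z‖ ^ 2))) := by
      gcongr
      linarith
    linarith
  -- Both sides carry the factor `1 / (1 - ‖z‖ ^ 2)`. Clearing it is what lets the estimate survive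
  -- `‖z‖ → 1`.
  have e6 := mul_le_mul_of_nonneg_right e5 (mul_pos hw1 hz1).le
  have e7 : 2 * (‖w - z‖ ^ 2 / ((1 - ‖w‖ ^ 2) * (1 - ‖z‖ ^ 2))) *
      ((1 - ‖w‖ ^ 2) * (1 - ‖z‖ ^ 2)) = 2 * ‖w - z‖ ^ 2 := by field_simp
  have e8 : Real.exp R * (2 * (2 / (1 - ‖z‖ ^ 2))) * ((1 - ‖w‖ ^ 2) * (1 - ‖z‖ ^ 2)) =
      4 * Real.exp R * (1 - ‖w‖ ^ 2) := by
    field_simp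
    ring
  rw [e7, e8] at e6
  linarith

section Polydisk

variable {n : ℕ} {f : (Fin n → ℂ) → (Fin n → ℂ)}

theorem smul_mem_polydisk {r : ℝ} (h0 : 0 < r) (h1 : r < 1) {z : Fin n → ℂ}
    (hz : z ∈ polydisk n) : r • z ∈ polydisk n := by
  rw [polydisk, mem_ball_zero_iff] at *
  rw [norm_smul, Real.norm_of_nonneg h0.le]
  nlinarith [norm_nonneg z]

/-- The positive bound `d` takes care of coordinates where `z` and `w` agree, in which nothing
shrinks strictly. -/
theorem dist_cayleyPi_smul_lt {r : ℝ} (h0 : 0 < r) (h1 : r < 1) {z w : Fin n → ℂ}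
    (hz : z ∈ polydisk n) (hw : w ∈ polydisk n) {d : ℝ} (hd : 0 < d)
    (h : dist (cayleyPi z) (cayleyPi w) ≤ d) :
    dist (cayleyPi (r • z)) (cayleyPi (r • w)) < d := by
  refine (dist_pi_lt_iff hd).2 fun j => ?_
  simp only [cayleyPi, Pi.smul_apply, Complex.real_smul]
  rcases eq_or_ne (z j) (w j) with he | he
  · simpa [he] using hd
  · exact (dist_cayley_mul_lt h0 h1 (mem_polydisk.1 hz j) (mem_polydisk.1 hw j) he).trans_le
      ((dist_le_pi_dist (cayleyPi z) (cayleyPi w) j).trans h)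

theorem dist_cayleyPi_smul_le {r : ℝ} (h0 : 0 < r) (h1 : r < 1) {z w : Fin n → ℂ}
    (hz : z ∈ polydisk n) (hw : w ∈ polydisk n) :
    dist (cayleyPi (r • z)) (cayleyPi (r • w)) ≤ dist (cayleyPi z) (cayleyPi w) :=
  le_of_forall_pos_le_add fun _ hε =>
    (dist_cayleyPi_smul_lt h0 h1 hz hw (by positivity) (by linarith)).le

/-- The map `r • f` strictly decreases distances and sends the polydisk into the compact ball of
radius `r`, so Edelstein's theorem applies. -/
theorem exists_smul_eq_self (hm : Set.MapsTo f (polydisk n) (polydisk n))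
    (hf : ∀ z ∈ polydisk n, ∀ w ∈ polydisk n,
      dist (cayleyPi (f z)) (cayleyPi (f w)) ≤ dist (cayleyPi z) (cayleyPi w))
    {r : ℝ} (h0 : 0 < r) (h1 : r < 1) : ∃ z ∈ polydisk n, r • f z = z := by
  have hsub : closedBall (0 : Fin n → ℂ) r ⊆ polydisk n := closedBall_subset_ball h1
  have hK : IsCompact (cayleyPi '' closedBall (0 : Fin n → ℂ) r) :=
    (isCompact_closedBall _ _).image_of_continuousOn (continuousOn_cayleyPi.mono hsub)
  set T : (Fin n → ℍ) → (Fin n → ℍ) := fun τ => cayleyPi (r • f (cayleyPiInv τ)) with hTdef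
  have hmap : Set.MapsTo T (cayleyPi '' closedBall 0 r) (cayleyPi '' closedBall 0 r) := by
    intro τ _
    refine ⟨_, ?_, rfl⟩
    have := hm (cayleyPiInv_mem τ)
    rw [polydisk, mem_ball_zero_iff] at this
    rw [mem_closedBall_zero_iff, norm_smul, Real.norm_of_nonneg h0.le]
    nlinarith
  have hT : ∀ τ σ, τ ≠ σ → dist (T τ) (T σ) < dist τ σ := by
    intro τ σ hne
    refine dist_cayleyPi_smul_lt h0 h1 (hm (cayleyPiInv_mem τ)) (hm (cayleyPiInv_mem σ))
      (dist_pos.2 hne) ?_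
    simpa only [cayleyPi_cayleyPiInv] using
      hf _ (cayleyPiInv_mem τ) _ (cayleyPiInv_mem σ)
  obtain ⟨_, ⟨z, hz, rfl⟩, hfix⟩ := hK.exists_fixedPoint_of_dist_lt
    ⟨_, 0, mem_closedBall_self h0.le, rfl⟩ hmap fun τ _ σ _ => hT τ σ
  refine ⟨z, hsub hz, ?_⟩
  have := congrArg cayleyPiInv hfix
  simp only [hTdef, cayleyPiInv_cayleyPi (hsub hz)] at this
  rwa [cayleyPiInv_cayleyPi (smul_mem_polydisk h0 h1 (hm (hsub hz)))] at this

theorem continuousOn_of_dist_cayleyPi_le (hm : Set.MapsTo f (polydisk n) (polydisk n))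
    (hf : ∀ z ∈ polydisk n, ∀ w ∈ polydisk n,
      dist (cayleyPi (f z)) (cayleyPi (f w)) ≤ dist (cayleyPi z) (cayleyPi w)) :
    ContinuousOn f (polydisk n) := by
  have hg : Continuous fun τ => cayleyPi (f (cayleyPiInv τ)) := by
    refine (LipschitzWith.of_dist_le_mul (K := 1) fun τ σ => ?_).continuous
    simpa only [cayleyPi_cayleyPiInv, NNReal.coe_one, one_mul] using
      hf _ (cayleyPiInv_mem τ) _ (cayleyPiInv_mem σ)
  refine ((continuous_cayleyPiInv.comp hg).comp_continuousOn continuousOn_cayleyPi).congr ?_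
  intro z hz
  simp only [Function.comp_apply, cayleyPiInv_cayleyPi hz, cayleyPiInv_cayleyPi (hm hz)]

/-- The orbits of a nonexpansive self-map of the polydisk without fixed points have no cluster
points in the polydisk. -/
theorem notMem_polydisk_of_tendsto_iterate (hm : Set.MapsTo f (polydisk n) (polydisk n))
    (hf : ∀ z ∈ polydisk n, ∀ w ∈ polydisk n,
      dist (cayleyPi (f z)) (cayleyPi (f w)) ≤ dist (cayleyPi z) (cayleyPi w))
    (hfix : ∀ z ∈ polydisk n, f z ≠ z) {x y : Fin n → ℂ} (hx : x ∈ polydisk n) {κ : ℕ → ℕ}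
    (hκ : StrictMono κ) (hy : Tendsto (fun m => f^[κ m] x) atTop (𝓝 y)) : y ∉ polydisk n := by
  intro hyD
  set g : (Fin n → ℍ) → (Fin n → ℍ) := fun τ => cayleyPi (f (cayleyPiInv τ)) with hgdef
  have hg : ∀ τ σ, dist (g τ) (g σ) ≤ dist τ σ := fun τ σ => by
    simpa only [cayleyPi_cayleyPiInv] using hf _ (cayleyPiInv_mem τ) _ (cayleyPiInv_mem σ)
  have hiter : ∀ k, g^[k] (cayleyPi x) = cayleyPi (f^[k] x) := by
    intro k
    induction k with
    | zero => rfl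
    | succ k ih =>
      rw [Function.iterate_succ_apply', ih, Function.iterate_succ_apply', hgdef]
      simp only [cayleyPiInv_cayleyPi (hm.iterate k hx)]
  have hlim : Tendsto (fun m => g^[κ m] (cayleyPi x)) atTop (𝓝 (cayleyPi y)) := by
    simp only [hiter]
    exact (continuousOn_cayleyPi.continuousAt (isOpen_ball.mem_nhds hyD)).tendsto.comp hy
  have hfreq : ∃ᶠ k in atTop, dist (g^[k] (cayleyPi x)) (cayleyPi y) < 1 / 2 :=
    hκ.tendsto_atTop.frequently
      (hlim.eventually (ball_mem_nhds _ one_half_pos)).frequently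
  obtain ⟨τ, hτ⟩ := exists_fixedPoint_of_isBounded_range_iterate hg
    (isBounded_range_iterate_of_frequently hg hfreq)
  refine hfix _ (cayleyPiInv_mem τ) ?_
  have := congrArg cayleyPiInv hτ
  rwa [hgdef, cayleyPiInv_cayleyPi (hm (cayleyPiInv_mem τ))] at this

/-- Fixed points of the maps `r • f`, `r → 1`, are asymptotically not farther from `f^[k] x` than
from `x`. -/
theorem eventually_dist_iterate_le (hm : Set.MapsTo f (polydisk n) (polydisk n))
    (hf : ∀ z ∈ polydisk n, ∀ w ∈ polydisk n,
      dist (cayleyPi (f z)) (cayleyPi (f w)) ≤ dist (cayleyPi z) (cayleyPi w))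
    {r : ℕ → ℝ} (hr : ∀ m, 0 < r m ∧ r m < 1) (hr1 : Tendsto r atTop (𝓝 1))
    {z : ℕ → Fin n → ℂ} (hz : ∀ m, z m ∈ polydisk n) (hfz : ∀ m, r m • f (z m) = z m)
    {x : Fin n → ℂ} (hx : x ∈ polydisk n) (k : ℕ) :
    ∀ ε > 0, ∀ᶠ m in atTop, dist (cayleyPi (f^[k] x)) (cayleyPi (z m)) ≤
      dist (cayleyPi x) (cayleyPi (z m)) + ε := by
  induction k with
  | zero => exact fun ε hε => Eventually.of_forall fun m => by simp [hε.le]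
  | succ k ih =>
    intro ε hε
    set u := f^[k] x with hu
    have huD : u ∈ polydisk n := hm.iterate k hx
    -- Only `r m • f` fixes `z m`. Replacing `f u` by `r m • f u` costs an error that vanishes as `m
    -- → ∞`, for each fixed `u`.
    have h1 : Tendsto (fun m => cayleyPi (r m • f u)) atTop (𝓝 (cayleyPi (f u))) := by
      refine (continuousOn_cayleyPi.continuousAt (isOpen_ball.mem_nhds (hm huD))).tendsto.comp ?_
      simpa using hr1.smul_const (f u)
    filter_upwards [ih (ε / 2) (half_pos hε),
      h1.eventually (closedBall_mem_nhds _ (half_pos hε))] with m hm1 hm2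
    rw [Function.iterate_succ_apply', ← hu]
    have h2 := dist_triangle (cayleyPi (f u)) (cayleyPi (r m • f u)) (cayleyPi (z m))
    have h3 := dist_cayleyPi_smul_le (hr m).1 (hr m).2 (hm huD) (hm (hz m))
    rw [hfz] at h3
    have h4 := hf u huD (z m) (hz m)
    have h5 : dist (cayleyPi (f u)) (cayleyPi (r m • f u)) ≤ ε / 2 := by
      rw [dist_comm]
      exact hm2
    linarith

/-- A coordinate of the orbit stays in a horodisk. -/
theorem norm_iterate_sub_sq_le (hm : Set.MapsTo f (polydisk n) (polydisk n))
    (hf : ∀ z ∈ polydisk n, ∀ w ∈ polydisk n,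
      dist (cayleyPi (f z)) (cayleyPi (f w)) ≤ dist (cayleyPi z) (cayleyPi w))
    {r : ℕ → ℝ} (hr : ∀ m, 0 < r m ∧ r m < 1) (hr1 : Tendsto r atTop (𝓝 1))
    {z : ℕ → Fin n → ℂ} (hz : ∀ m, z m ∈ polydisk n) (hfz : ∀ m, r m • f (z m) = z m)
    {j : Fin n} (hj : ∀ᶠ m in atTop, ∀ i, ‖z m i‖ ≤ ‖z m j‖) {c : ℂ}
    (hc : Tendsto (fun m => z m j) atTop (𝓝 c)) {x : Fin n → ℂ} (hx : x ∈ polydisk n) (k : ℕ) :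
    ‖f^[k] x j - c‖ ^ 2 ≤
      2 * Real.exp (dist (cayleyPi x) (cayleyPi 0) + 1) * (1 - ‖f^[k] x j‖ ^ 2) := by
  refine le_of_tendsto ((tendsto_const_nhds.sub hc).norm.pow 2) ?_
  filter_upwards [hj, eventually_dist_iterate_le hm hf hr hr1 hz hfz hx k 1 one_pos] with m h1 h2
  have hzm := mem_polydisk.1 (hz m)
  refine norm_sub_sq_le_of_dist_cayley_le (mem_polydisk.1 (hm.iterate k hx) j) (hzm j) ?_
  -- The dominant coordinate realizes the distance from the origin, which turns the sup-distance
  -- bound into one for coordinate `j` alone, with a constant independent of `k`.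
  have h3 : dist (cayleyPi 0) (cayleyPi (z m)) ≤ dist (cayley 0) (cayley (z m j)) := by
    refine (dist_pi_le_iff dist_nonneg).2 fun i => ?_
    simp only [cayleyPi, Pi.zero_apply]
    rw [dist_cayley_le_iff (by simp) (hzm i) (by simp) (hzm j)]
    simpa using h1 i
  have h4 := dist_le_pi_dist (cayleyPi (f^[k] x)) (cayleyPi (z m)) j
  have h5 := dist_triangle (cayleyPi x) (cayleyPi 0) (cayleyPi (z m))
  simp only [cayleyPi] at h2 h3 h4 h5 ⊢
  linarith

end Polydisk

/-- The `j`-th set of the union is the product with `C_j(ξ)` as its `j`-th factor and the closed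
unit disk as every other factor. -/
theorem corollary4p1 (n : ℕ) (f : (Fin n → ℂ) → (Fin n → ℂ))
    (hmaps : Set.MapsTo f (polydisk n) (polydisk n))
    (hf : KobayashiNonexpansiveOn f (polydisk n) ∨ DifferentiableOn ℂ f (polydisk n))
    (hfix : ∀ z ∈ polydisk n, f z ≠ z) :
    ∃ ξ ∈ frontier (polydisk n),
      targetSet f (polydisk n) ⊆
        ⋃ j : Fin n, Set.pi Set.univ
          (Function.update (fun _ : Fin n => Metric.closedBall (0 : ℂ) 1) j
            (boundaryFactor ξ j)) := by
  have hne : ∀ z ∈ polydisk n, ∀ w ∈ polydisk n,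
      dist (cayleyPi (f z)) (cayleyPi (f w)) ≤ dist (cayleyPi z) (cayleyPi w) := fun z hz w hw =>
    (hf.elim id fun h => h.kobayashiNonexpansiveOn hmaps).dist_cayleyPi_le hmaps hz hw
  -- For `n = 0` the polydisk is a single point, which `f` fixes.
  have hFin : Nonempty (Fin n) := by
    by_contra h
    rw [not_nonempty_iff] at h
    exact hfix 0 (by simp [polydisk]) (Subsingleton.elim _ _)
  have hr := one_sub_one_div_add_two_mem
  have hr1 := tendsto_one_sub_one_div_add_two
  choose z hz hfz using fun m : ℕ => exists_smul_eq_self hmaps hne (hr m).1 (hr m).2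
  choose i hi using fun m => Finite.exists_max fun j => ‖z m j‖
  -- Compactness of the finite index set makes the dominant coordinate eventually constant along the
  -- same subsequence.
  obtain ⟨⟨p, j⟩, -, κ, hκ, hlim⟩ :=
    ((isCompact_closedBall (0 : Fin n → ℂ) 1).prod (isCompact_univ (X := Fin n))).tendsto_subseq
      (x := fun m => (z m, i m)) fun m => ⟨ball_subset_closedBall (hz m), Set.mem_univ _⟩
  have hp : Tendsto (fun m => z (κ m)) atTop (𝓝 p) := (continuous_fst.tendsto _).comp hlim
  have hpj : ∀ l, Tendsto (fun m => z (κ m) l) atTop (𝓝 (p l)) := tendsto_pi_nhds.1 hp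
  have hij : ∀ᶠ m in atTop, i (κ m) = j :=
    ((continuous_snd.tendsto _).comp hlim).eventually
      ((isOpen_discrete {j}).mem_nhds rfl)
  have hmax : ∀ᶠ m in atTop, ∀ l, ‖z (κ m) l‖ ≤ ‖z (κ m) j‖ := by
    filter_upwards [hij] with m hm l
    exact hm ▸ hi (κ m) l
  -- An interior limit would satisfy `f p = p` by continuity.
  have hpD : p ∉ polydisk n := by
    intro hpD
    have h1 := (((continuousOn_of_dist_cayleyPi_le hmaps hne).continuousAt
      (isOpen_ball.mem_nhds hpD)).tendsto.comp hp)
    have h2 := (hr1.comp hκ.tendsto_atTop).smul h1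
    rw [one_smul] at h2
    exact hfix p hpD (tendsto_nhds_unique h2 (hp.congr fun m => (hfz (κ m)).symm))
  have hle : ∀ l, ‖p l‖ ≤ ‖p j‖ := fun l => le_of_tendsto_of_tendsto (hpj l).norm (hpj j).norm
    (hmax.mono fun m h => h l)
  have hpj1 : ‖p j‖ = 1 := by
    refine le_antisymm (le_of_tendsto (hpj j).norm (Eventually.of_forall fun m =>
      (mem_polydisk.1 (hz (κ m)) j).le)) ?_
    by_contra! h
    exact hpD (mem_polydisk.2 fun l => (hle l).trans_lt h)
  -- The horodisk estimate is available for coordinate `j` only, so the other coordinates of `p` are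
  -- replaced by 0 and their factors are whole circles.
  refine ⟨Pi.single j (p j), ?_, ?_⟩
  · rw [polydisk, frontier_ball _ one_ne_zero, mem_sphere_zero_iff_norm, Pi.norm_single, hpj1]
  · intro y hy
    simp only [targetSet, Set.mem_ofPred_eq, Set.mem_iUnion, Set.mem_image] at hy
    obtain ⟨h, ⟨σ, hσ, hconv⟩, x, hx, rfl⟩ := hy
    have hlim : Tendsto (fun m => f^[σ m] x) atTop (𝓝 (h x)) :=
      (hconv {x} (by simpa using hx) isCompact_singleton).tendsto_at rfl
    have hliml : ∀ l, Tendsto (fun m => f^[σ m] x l) atTop (𝓝 (h x l)) := tendsto_pi_nhds.1 hlim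
    have hle1 : ∀ l, ‖h x l‖ ≤ 1 := fun l => le_of_tendsto (hliml l).norm
      (Eventually.of_forall fun m => (mem_polydisk.1 (hmaps.iterate (σ m) hx) l).le)
    have hnot := notMem_polydisk_of_tendsto_iterate hmaps hne hfix hx hσ hlim
    rw [mem_polydisk] at hnot
    push Not at hnot
    obtain ⟨l, hl⟩ := hnot
    have hl1 : ‖h x l‖ = 1 := le_antisymm (hle1 l) hl
    refine Set.mem_iUnion.2 ⟨l, fun q _ => ?_⟩
    rcases eq_or_ne q l with rfl | hql
    · rw [Function.update_self, boundaryFactor]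
      rcases eq_or_ne q j with rfl | hqj
      · have hhoro : ‖h x q - p q‖ ^ 2 ≤
            2 * Real.exp (dist (cayleyPi x) (cayleyPi 0) + 1) * (1 - ‖h x q‖ ^ 2) :=
          le_of_tendsto_of_tendsto (((hliml q).sub_const _).norm.pow 2)
            (((tendsto_const_nhds (x := (1 : ℝ))).sub ((hliml q).norm.pow 2)).const_mul _)
            (Eventually.of_forall fun m => norm_iterate_sub_sq_le hmaps hne (fun m => hr (κ m))
              (hr1.comp hκ.tendsto_atTop) (fun m => hz (κ m)) (fun m => hfz (κ m)) hmax (hpj q)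
              hx (σ m))
        rw [hl1, one_pow, sub_self, mul_zero] at hhoro
        have h0 : ‖h x q - p q‖ = 0 :=
          pow_eq_zero_iff two_ne_zero |>.1 (le_antisymm hhoro (sq_nonneg _))
        simpa [hpj1] using sub_eq_zero.1 (norm_eq_zero.1 h0)
      · simpa [hqj] using hl1
    · simpa [Function.update_of_ne hql] using hle1 q
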